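/- Let $\mathbf V$ be a finite set of nodes. Two DAGs on $\mathbf V$ are Markov equivalent if they have the same d-separations. The CPDAG of a DAG $D$ has the directed edge $u \to v$ if every DAG Markov equivalent to $D$ has the edge $u \to v$, and the undirected edge $u - v$ if some of these DAGs have $u \to v$ and others have $v \to u$. A CPDAG $G$ represents the Markov equivalence class (MEC) of all DAGs whose CPDAG is $G$. A node $X$ is a possible ancestor of $Y$ in $G$ if $X$ is an ancestor of $Y$ in at least one DAG in the MEC represented by $G$, and an explicit ancestor of $Y$ in $G$ if there is a directed path from $X$ to $Y$ in $G$. For a DAG $D$ and distinct nodes $X, Y$, a set $\mathbf Z \subseteq \mathbf V \setminus \{X, Y\}$ is a valid adjustment set relative to $(X,Y)$ in $D$ if for every positive density $f(\mathbf v) = \prod_{V \in \mathbf V} f(v \mid pa_D(v))$ that factorizes according to $D$ (with respect to a product of $\sigma$-finite measures on arbitrary state spaces), $$ f(y \mid do(x)) = \int f(y \mid x, \mathbf z)\, f(\mathbf z)\, d\mathbf z \quad \text{almost everywhere} $$ (read as $f(y \mid do(x)) = f(y \mid x)$ if $\mathbf Z = \emptyset$), where $f(y \mid do(x))$ is obtained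 from the truncated factorization $\prod_{V \neq X} f(v \mid pa_D(v))$ by integrating out all variables other than $X$ and $Y$. The causal effect of $X$ on $Y$ is identifiable in a CPDAG $G$ if there is one set $\mathbf Z$ that is a valid adjustment set relative to $(X, Y)$ in all DAGs in the MEC represented by $G$. **Lemma.** Let $X$ and $Y$ be distinct nodes of a CPDAG $G$ such that $X$ is a possible ancestor of $Y$ in $G$. Then the causal effect of $X$ on $Y$ is identifiable in $G$ only if $X$ is an explicit ancestor of $Y$ in $G$, that is, only if $G$ contains a directed path from $X$ to $Y$. -/

import Mathlib

open MeasureTheory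
open scoped ENNReal

/-- A directed acyclic graph on the node set `V`; `D.edge u v` means `u → v`. -/
structure CausalDAG (V : Type*) where
  edge : V → V → Prop
  acyclic : ∀ v, ¬ Relation.TransGen edge v v

/-- A graph with directed edges `u → v` (`G.dir u v`) and undirected edges `u - v` (`G.undir u v`). -/
structure MixedGraph (V : Type*) where
  dir : V → V → Prop
  undir : V → V → Prop

namespace CausalDAG

variable {V : Type*}

/-- `u` is an ancestor of `v`: there is a directed path from `u` to `v`, or `u = v`. -/
def IsAncestor (D : CausalDAG V) (u v : V) : Prop :=
  Relation.ReflTransGen D.edge u v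

/-- The skeleton: two distinct nodes are adjacent if there is an edge between them in some
direction. -/
def skeleton (D : CausalDAG V) : SimpleGraph V :=
  SimpleGraph.fromRel D.edge

/-- The path `w` is open given `S`: every interior node of `w` that is a collider on `w` has a
descendant in `S` (every node being its own descendant), and every other interior node of `w` lies
outside `S`. The interior nodes are `w.getVert (i + 1)` with `i + 1 < w.length`. -/
def IsOpen (D : CausalDAG V) (S : Set V) {x y : V} (w : D.skeleton.Walk x y) : Prop :=
  ∀ i : ℕ, i + 1 < w.length →
    ((D.edge (w.getVert i) (w.getVert (i + 1)) ∧
        D.edge (w.getVert (i + 2)) (w.getVert (i + 1))) →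
      ∃ s ∈ S, D.IsAncestor (w.getVert (i + 1)) s) ∧
    (¬ (D.edge (w.getVert i) (w.getVert (i + 1)) ∧
        D.edge (w.getVert (i + 2)) (w.getVert (i + 1))) →
      w.getVert (i + 1) ∉ S)

/-- `x` and `y` are d-separated by `S`: no path (a walk without repeated nodes) between them is
open given `S`. -/
def DSep (D : CausalDAG V) (x y : V) (S : Set V) : Prop :=
  ∀ w : D.skeleton.Walk x y, w.IsPath → ¬ D.IsOpen S w

/-- Two DAGs are Markov equivalent if they imply the same conditional independences, i.e. have the
same d-separations. -/
def MarkovEquiv (D D' : CausalDAG V) : Prop :=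
  ∀ (x y : V) (S : Set V), x ≠ y → x ∉ S → y ∉ S → (D.DSep x y S ↔ D'.DSep x y S)

/-- The CPDAG of `D`, representing the Markov equivalence class of `D`: it has `u → v` if all DAGs
of the class have `u → v`, and `u - v` if some of them have `u → v` and others `v → u`. -/
def cpdag (D : CausalDAG V) : MixedGraph V where
  dir u v := ∀ D' : CausalDAG V, D.MarkovEquiv D' → D'.edge u v
  undir u v := (∃ D' : CausalDAG V, D.MarkovEquiv D' ∧ D'.edge u v) ∧
    ∃ D' : CausalDAG V, D.MarkovEquiv D' ∧ D'.edge v u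

/-- A causal model over the DAG `D`: variables indexed by the nodes, with state spaces `Ω v` and
reference measures `μ v`, and for each node `v` a positive conditional density
`cond v ω = f(ω_v | ω_{Pa(v)})` of `v` given its parents. -/
structure Model (D : CausalDAG V) [DecidableEq V] (Ω : V → Type) [∀ v, MeasurableSpace (Ω v)]
    (μ : ∀ v, Measure (Ω v)) where
  cond : V → (∀ v, Ω v) → ℝ≥0∞
  measurable_cond : ∀ v, Measurable (cond v)
  cond_pos : ∀ v ω, 0 < cond v ω
  cond_ne_top : ∀ v ω, cond v ω ≠ ∞
  cond_local : ∀ v ω ω', ω v = ω' v → (∀ u, D.edge u v → ω u = ω' u) → cond v ω = cond v ω'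
  cond_normalized : ∀ v ω, ∫⁻ t, cond v (Function.update ω v t) ∂(μ v) = 1

namespace Model

variable [Fintype V] [DecidableEq V] {D : CausalDAG V} {Ω : V → Type}
  [∀ v, MeasurableSpace (Ω v)] {μ : ∀ v, Measure (Ω v)}

/-- The observational density `f(ω) = ∏ v, f(ω_v | ω_{Pa(v)})`. -/
noncomputable def density (M : D.Model Ω μ) (ω : ∀ v, Ω v) : ℝ≥0∞ :=
  ∏ v, M.cond v ω

/-- The marginal density `f(ω_S)` of the variables in `S`: all others are integrated out. -/
noncomputable def marginal (M : D.Model Ω μ) (S : Finset V) (ω : ∀ v, Ω v) : ℝ≥0∞ :=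
  lmarginal μ Sᶜ M.density ω

/-- The interventional density `f(ω_Y | do(ω_X))`: in the factorization of the density the factor
of `X` is deleted, and all variables except `X` and `Y` are integrated out. -/
noncomputable def doDensity (M : D.Model Ω μ) (X Y : V) (ω : ∀ v, Ω v) : ℝ≥0∞ :=
  lmarginal μ {X, Y}ᶜ (fun ω' => ∏ v ∈ Finset.univ.erase X, M.cond v ω') ω

/-- The adjustment formula `∫ f(ω_Y | ω_X, ω_Z) f(ω_Z) dω_Z`; for `Z = ∅` it is
`f(ω_Y | ω_X)`. -/
noncomputable def adjusted (M : D.Model Ω μ) (X Y : V) (Z : Finset V) (ω : ∀ v, Ω v) : ℝ≥0∞ :=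
  lmarginal μ Z
    (fun ω' => M.marginal (insert X (insert Y Z)) ω' / M.marginal (insert X Z) ω'
      * M.marginal Z ω') ω

end Model

/-- `Z` is a valid adjustment set relative to `(X, Y)` in `D`: it contains neither `X` nor `Y`, and
in every causal model over `D` (with arbitrary state spaces and σ-finite reference measures) the
interventional density of `Y` under `do(X)` is given by the adjustment formula. -/
def IsValidAdjustmentSet [Fintype V] [DecidableEq V] (D : CausalDAG V) (X Y : V)
    (Z : Finset V) : Prop :=
  X ∉ Z ∧ Y ∉ Z ∧
    ∀ (Ω : V → Type) [∀ v, MeasurableSpace (Ω v)] (μ : ∀ v, Measure (Ω v))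
      [∀ v, SigmaFinite (μ v)] (M : D.Model Ω μ),
      M.doDensity X Y =ᵐ[Measure.pi μ] M.adjusted X Y Z

end CausalDAG

namespace MixedGraph

variable {V : Type*}

/-- `G` is a CPDAG, i.e. the CPDAG of some DAG. -/
def IsCPDAG (G : MixedGraph V) : Prop :=
  ∃ D : CausalDAG V, D.cpdag = G

/-- The Markov equivalence class represented by `G`: the DAGs whose CPDAG is `G`. -/
def mec (G : MixedGraph V) : Set (CausalDAG V) :=
  {D | D.cpdag = G}

/-- The possible ancestors of `y`: the ancestors of `y` in at least one DAG of the class. -/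
def possAn (G : MixedGraph V) (y : V) : Set V :=
  {x | ∃ D ∈ G.mec, D.IsAncestor x y}

/-- The explicit ancestors of `y`: the nodes with a directed path to `y` in `G` itself. -/
def explAn (G : MixedGraph V) (y : V) : Set V :=
  {x | Relation.ReflTransGen G.dir x y}

/-- The causal effect of `X` on `Y` is identifiable: the DAGs in the Markov equivalence class
represented by `G` share a valid adjustment set. -/
def Identifiable [Fintype V] [DecidableEq V] (G : MixedGraph V) (X Y : V) : Prop :=
  ∃ Z : Finset V, ∀ D ∈ G.mec, D.IsValidAdjustmentSet X Y Z

end MixedGraph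

/-! Take a shortest directed path from X to Y in a DAG `D` of the class. It is unshielded, and
Markov equivalent DAGs share adjacencies and unshielded non-colliders, so it is a collider-free path
in every DAG of the class. If its first edge leaves X in all of them, the absence of colliders
forces every later edge forward as well, and the path is directed in `G`. Otherwise some `D'` in the
class has the first edge pointing into X. Put correlated fair coins along the path (`pathModel`):
the joint density is the same over `D` and `D'`, hence so is the adjustment formula. But deleting
the factor of X keeps the whole chain in `D`, leaving correlation 2^(-k) between X and Y, while in
`D'` it cuts the first edge and leaves 0. No set is valid in both (`not_common_adjustmentSet`). -/

namespace CausalDAG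

/-! ### Markov equivalence: adjacencies, colliders, shortest paths -/

section Graph

variable {V : Type*} {D D' : CausalDAG V}

theorem not_edge_of_edge {u v : V} (h : D.edge u v) : ¬ D.edge v u := fun h' =>
  D.acyclic u (.tail (.single h) h')

theorem ne_of_edge {u v : V} (h : D.edge u v) : u ≠ v := by
  rintro rfl
  exact D.acyclic u (.single h)

theorem skeleton_adj {u v : V} : D.skeleton.Adj u v ↔ D.edge u v ∨ D.edge v u := by
  rw [skeleton, SimpleGraph.fromRel_adj]
  refine ⟨fun h => h.2, fun h => ⟨?_, h⟩⟩
  rcases h with h | h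
  · exact ne_of_edge h
  · exact (ne_of_edge h).symm

/-- A node is d-separated by its parents from every nonadjacent node that is not its descendant. -/
theorem dSep_parents {x y : V} (hxy : x ≠ y) (hadj : ¬ D.skeleton.Adj x y)
    (hanc : ¬ D.IsAncestor y x) : D.DSep x y {u | D.edge u y} := by
  intro w _ hw
  have hn : 2 ≤ w.length := by
    by_contra! hlt
    have h01 : w.length = 0 ∨ w.length = 1 := by omega
    rcases h01 with h | h
    · exact hxy (SimpleGraph.Walk.eq_of_length_eq_zero h)
    · exact hadj (SimpleGraph.Walk.adj_of_length_eq_one h)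
  -- Read an open path backwards from `y`. Its last edge must leave `y`, since a parent of `y` there
  -- would be a non-collider in the separating set. Every earlier edge also points away from `y`: a
  -- collider would have a parent of `y` as descendant, closing a cycle.
  have key : ∀ t i : ℕ, i + 1 + t = w.length →
      D.edge (w.getVert (i + 1)) (w.getVert i) ∧ D.IsAncestor y (w.getVert i) := by
    intro t
    induction t with
    | zero =>
      intro i hi
      obtain ⟨j, rfl⟩ : ∃ j, i = j + 1 := ⟨i - 1, by omega⟩
      have hy : w.getVert (j + 1 + 1) = y := by
        rw [show j + 1 + 1 = w.length by omega, w.getVert_length]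
      have hedge : D.edge (w.getVert (j + 1 + 1)) (w.getVert (j + 1)) := by
        rcases skeleton_adj.1 (w.adj_getVert_succ (i := j + 1) (by omega)) with h | h
        · refine absurd ?_ ((hw j (by omega)).2 fun hc => not_edge_of_edge h hc.2)
          simpa [hy] using h
        · exact h
      refine ⟨hedge, ?_⟩
      rw [hy] at hedge
      exact .single hedge
    | succ t ih =>
      intro i hi
      obtain ⟨h1, h2⟩ := ih (i + 1) (by omega)
      have hedge : D.edge (w.getVert (i + 1)) (w.getVert i) := by
        rcases skeleton_adj.1 (w.adj_getVert_succ (i := i) (by omega)) with h | h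
        · obtain ⟨s, hs, hs'⟩ := (hw i (by omega)).1 ⟨h, h1⟩
          exact absurd (Relation.TransGen.tail' (h2.trans hs') hs) (D.acyclic y)
        · exact h
      exact ⟨hedge, h2.tail hedge⟩
  apply hanc
  have := (key (w.length - 1) 0 (by omega)).2
  rwa [w.getVert_zero] at this

/-- By acyclicity one of the nodes is not an ancestor of the other, so the parents of the other one
separate. The disjunction avoids proving that `DSep` is symmetric. -/
theorem exists_dSep_of_not_adj {x y : V} (hxy : x ≠ y) (hadj : ¬ D.skeleton.Adj x y) :
    ∃ S : Set V, x ∉ S ∧ y ∉ S ∧ (D.DSep x y S ∨ D.DSep y x S) := by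
  by_cases hanc : D.IsAncestor y x
  · refine ⟨{u | D.edge u x}, fun h => ne_of_edge h rfl,
      fun h => hadj (skeleton_adj.2 (.inr h)), .inr ?_⟩
    refine dSep_parents hxy.symm (fun h => hadj h.symm) fun h => ?_
    rcases Relation.reflTransGen_iff_eq_or_transGen.1 hanc with h' | h'
    · exact hxy h'
    · exact D.acyclic y (h'.trans_left h)
  · exact ⟨{u | D.edge u y}, fun h => hadj (skeleton_adj.2 (.inl h)),
      fun h => ne_of_edge h rfl, .inl (dSep_parents hxy hadj hanc)⟩

theorem not_dSep_of_adj {x y : V} (h : D.skeleton.Adj x y) (S : Set V) : ¬ D.DSep x y S := by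
  intro hS
  refine hS h.toWalk (SimpleGraph.Walk.IsPath.of_adj h) fun i hi => ?_
  simp at hi

/-- Whether a middle node of an unshielded triple belongs to a separating set of the outer nodes
tells whether it is a collider. -/
theorem mem_iff_not_collider_of_dSep {a b c : V} {S : Set V} (hab : D.skeleton.Adj a b)
    (hbc : D.skeleton.Adj b c) (hac : a ≠ c) (hS : D.DSep a c S) :
    b ∈ S ↔ ¬ (D.edge a b ∧ D.edge c b) := by
  have hpath : (SimpleGraph.Walk.cons hab (.cons hbc .nil)).IsPath := by
    simp [SimpleGraph.Walk.cons_isPath_iff, hab.ne, hbc.ne, hac]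
  have hopen := hS _ hpath
  constructor
  · intro hb hcol
    refine hopen fun i hi => ?_
    obtain rfl : i = 0 := by simp at hi; omega
    exact ⟨fun _ => ⟨b, hb, .refl⟩, fun h => absurd hcol h⟩
  · intro hcol
    by_contra hb
    refine hopen fun i hi => ?_
    obtain rfl : i = 0 := by simp at hi; omega
    exact ⟨fun h => absurd h hcol, fun _ => hb⟩

theorem MarkovEquiv.symm (h : D.MarkovEquiv D') : D'.MarkovEquiv D :=
  fun x y S hxy hx hy => (h x y S hxy hx hy).symm

theorem MarkovEquiv.trans {D'' : CausalDAG V} (h : D.MarkovEquiv D') (h' : D'.MarkovEquiv D'') :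
    D.MarkovEquiv D'' :=
  fun x y S hxy hx hy => (h x y S hxy hx hy).trans (h' x y S hxy hx hy)

theorem MarkovEquiv.cpdag_eq (h : D.MarkovEquiv D') : D.cpdag = D'.cpdag := by
  have key : ∀ E : CausalDAG V, D.MarkovEquiv E ↔ D'.MarkovEquiv E :=
    fun E => ⟨h.symm.trans, h.trans⟩
  simp only [cpdag, key]

theorem MarkovEquiv.adj_of_adj (h : D.MarkovEquiv D') {x y : V} (hxy : D.skeleton.Adj x y) :
    D'.skeleton.Adj x y := by
  by_contra hadj
  obtain ⟨S, hx, hy, hS | hS⟩ := exists_dSep_of_not_adj hxy.ne hadj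
  · exact not_dSep_of_adj hxy S ((h x y S hxy.ne hx hy).2 hS)
  · exact not_dSep_of_adj hxy.symm S ((h y x S hxy.ne.symm hy hx).2 hS)

/-- A set separating `a` and `c` in `D` also does so in `D'`, and whether it contains `b` decides
the collider status in both. -/
theorem MarkovEquiv.not_collider (h : D.MarkovEquiv D') {a b c : V} (hab : D.skeleton.Adj a b)
    (hbc : D.skeleton.Adj b c) (hac : a ≠ c) (hadj : ¬ D.skeleton.Adj a c)
    (hcol : ¬ (D.edge a b ∧ D.edge c b)) : ¬ (D'.edge a b ∧ D'.edge c b) := by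
  have hab' := h.adj_of_adj hab
  have hbc' := h.adj_of_adj hbc
  obtain ⟨S, ha, hc, hS | hS⟩ := exists_dSep_of_not_adj hac hadj
  · exact (mem_iff_not_collider_of_dSep hab' hbc' hac ((h a c S hac ha hc).1 hS)).1
      ((mem_iff_not_collider_of_dSep hab hbc hac hS).2 hcol)
  · rw [and_comm] at hcol ⊢
    exact (mem_iff_not_collider_of_dSep hbc'.symm hab'.symm hac.symm
      ((h c a S hac.symm hc ha).1 hS)).1
      ((mem_iff_not_collider_of_dSep hbc.symm hab.symm hac.symm hS).2 hcol)

/-- `p 0 → p 1 → ⋯ → p k` is a directed path of `D` from `x` to `y`. -/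
def IsDirectedPath (D : CausalDAG V) (x y : V) (k : ℕ) (p : ℕ → V) : Prop :=
  p 0 = x ∧ p k = y ∧ ∀ i < k, D.edge (p i) (p (i + 1))

theorem IsAncestor.exists_isDirectedPath {x y : V} (h : D.IsAncestor x y) :
    ∃ k p, D.IsDirectedPath x y k p := by
  induction h with
  | refl => exact ⟨0, fun _ => x, rfl, rfl, fun i hi => absurd hi (by omega)⟩
  | @tail b c _ hbc ih =>
    obtain ⟨k, p, h0, hk, hp⟩ := ih
    refine ⟨k + 1, fun i => if i ≤ k then p i else c, by simpa using h0, by simp, ?_⟩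
    intro i hi
    rcases Nat.lt_succ_iff_lt_or_eq.1 hi with h | rfl
    · simpa [h.le, Nat.succ_le_of_lt h] using hp i h
    · simpa [hk] using hbc

theorem IsDirectedPath.transGen {x y : V} {k : ℕ} {p : ℕ → V} (h : D.IsDirectedPath x y k p)
    {i j : ℕ} (hij : i < j) (hj : j ≤ k) : Relation.TransGen D.edge (p i) (p j) := by
  induction j, hij using Nat.le_induction with
  | base => exact .single (h.2.2 i (by omega))
  | succ j _ ih => exact (ih (by omega)).tail (h.2.2 j (by omega))

theorem IsDirectedPath.injOn {x y : V} {k : ℕ} {p : ℕ → V} (h : D.IsDirectedPath x y k p) :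
    Set.InjOn p (Set.Iic k) := by
  intro i hi j hj hij
  by_contra hne
  rcases lt_or_gt_of_ne hne with hlt | hlt
  · exact D.acyclic _ (hij ▸ h.transGen hlt hj)
  · exact D.acyclic _ (hij ▸ h.transGen hlt hi)

/-- Along a shortest directed path, nodes at distance two are not adjacent. -/
theorem IsAncestor.exists_unshielded {x y : V} (h : D.IsAncestor x y) :
    ∃ k p, D.IsDirectedPath x y k p ∧
      ∀ i, i + 2 ≤ k → ¬ D.skeleton.Adj (p i) (p (i + 2)) := by
  classical
  have hex := h.exists_isDirectedPath
  obtain ⟨p, hp⟩ := Nat.find_spec hex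
  refine ⟨Nat.find hex, p, hp, fun i hi hadj => ?_⟩
  rcases skeleton_adj.1 hadj with he | he
  -- A forward chord skips `p (i + 1)` and shortens the path; a backward chord closes a cycle.
  · refine Nat.find_min hex (m := Nat.find hex - 1) (by omega)
      ⟨fun t => if t ≤ i then p t else p (t + 1), by simpa using hp.1, ?_, fun t ht => ?_⟩
    · have : ¬ (Nat.find hex - 1 ≤ i) := by omega
      simp only [this, if_false]
      rw [Nat.sub_add_cancel (by omega)]
      exact hp.2.1
    · rcases lt_trichotomy t i with hti | rfl | hti
      · simpa [hti.le, Nat.succ_le_of_lt hti] using hp.2.2 t (by omega)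
      · simpa using he
      · have h1 : ¬ t ≤ i := by omega
        have h2 : ¬ t + 1 ≤ i := by omega
        simpa [h1, h2] using hp.2.2 (t + 1) (by omega)
  · exact D.acyclic _ ((hp.transGen (i := i) (j := i + 2) (by omega) hi).tail he)

end Graph

/-! ### Pairs of correlated fair coins -/

section Coin

/-- The distribution of a fair coin. -/
noncomputable def coin : Measure Bool := (2⁻¹ : ℝ≥0∞) • Measure.count

theorem lintegral_coin (f : Bool → ℝ≥0∞) : ∫⁻ t, f t ∂coin = 2⁻¹ * (f true + f false) := by
  rw [coin, lintegral_smul_measure, lintegral_count, tsum_fintype, Fintype.sum_bool, smul_eq_mul]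

instance : IsProbabilityMeasure coin := by
  constructor
  have h := lintegral_coin fun _ => 1
  rw [lintegral_one, one_add_one_eq_two, ENNReal.inv_mul_cancel (by simp) (by simp)] at h
  exact h

theorem coin_singleton_ne_zero (b : Bool) : coin {b} ≠ 0 := by
  simp [coin]

/-- The density, with respect to a fair coin, of a `±1`-valued variable with correlation `c` to
another one. -/
noncomputable def flip (c : ℝ) (a b : Bool) : ℝ≥0∞ :=
  ENNReal.ofReal (1 + if a = b then c else -c)

theorem flip_comm (c : ℝ) (a b : Bool) : flip c a b = flip c b a := by
  simp only [flip, eq_comm]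

@[simp] theorem flip_zero (a b : Bool) : flip 0 a b = 1 := by
  simp [flip]

theorem flip_pos {c : ℝ} (hc : |c| < 1) (a b : Bool) : 0 < flip c a b := by
  rw [abs_lt] at hc
  rw [flip, ENNReal.ofReal_pos]
  split_ifs <;> linarith

/-- With signs ±1 the integrand is (1 + c·a·t)(1 + d·t·b); the terms linear in t average to 0 and t²
= 1. -/
theorem lintegral_flip_mul_flip {c d : ℝ} (hc : |c| ≤ 1) (hd : |d| ≤ 1) (a b : Bool) :
    ∫⁻ t, flip c a t * flip d t b ∂coin = flip (c * d) a b := by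
  rw [abs_le] at hc hd
  have h2 : (2⁻¹ : ℝ≥0∞) = ENNReal.ofReal 2⁻¹ := by
    rw [ENNReal.ofReal_inv_of_pos (by norm_num)]; simp
  have hp : ∀ (e : ℝ), -1 ≤ e → e ≤ 1 → ∀ x y : Bool, 0 ≤ 1 + if x = y then e else -e := by
    intro e h1 h2 x y
    split_ifs <;> linarith
  have hc' := hp c hc.1 hc.2
  have hd' := hp d hd.1 hd.2
  rw [lintegral_coin, h2]
  simp only [flip]
  rw [← ENNReal.ofReal_mul (hc' _ _), ← ENNReal.ofReal_mul (hc' _ _),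
    ← ENNReal.ofReal_add (mul_nonneg (hc' _ _) (hd' _ _)) (mul_nonneg (hc' _ _) (hd' _ _)),
    ← ENNReal.ofReal_mul (by norm_num)]
  congr 1
  cases a <;> cases b <;> simp <;> ring

theorem lintegral_flip {c : ℝ} (hc : |c| ≤ 1) (b : Bool) : ∫⁻ t, flip c t b ∂coin = 1 := by
  simpa using lintegral_flip_mul_flip (c := 0) (by simp) hc b b

/-- Every point has positive mass. -/
theorem eq_of_ae_eq_pi_coin {V : Type*} [Fintype V] {f g : (V → Bool) → ℝ≥0∞}
    (h : f =ᵐ[Measure.pi fun _ => coin] g) : f = g := by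
  funext ω
  by_contra hne
  have h0 : (Measure.pi fun _ : V => coin) {ω} = 0 :=
    measure_mono_null (by simpa using hne) (ae_iff.1 h)
  rw [Measure.pi_singleton, Finset.prod_eq_zero_iff] at h0
  obtain ⟨v, _, hv⟩ := h0
  exact coin_singleton_ne_zero _ hv

end Coin

/-! ### Marginals of a chain of coins -/

section Chain

variable {V : Type*} [DecidableEq V]

theorem lmarginal_eq_self_of_forall {Ω : V → Type*} [∀ v, MeasurableSpace (Ω v)]
    (μ : ∀ v, Measure (Ω v)) [∀ v, IsProbabilityMeasure (μ v)] (t : Finset V)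
    (f : (∀ v, Ω v) → ℝ≥0∞) (hf : ∀ ω ω', (∀ v ∉ t, ω v = ω' v) → f ω = f ω') :
    lmarginal μ t f = f := by
  funext ω
  have : ∀ y, f (Function.updateFinset ω t y) = f ω := fun y =>
    hf _ _ fun v hv => by simp [Function.updateFinset, hv]
  simp [lmarginal, this]

variable [Fintype V]

/-- Integrating out the last interior node merges the last two factors into one; the free
correlation `c` absorbs the product, which lets the induction run. -/
theorem lmarginal_chain (b : ℕ → ℝ) (hb : ∀ i, |b i| ≤ 1) (p : ℕ → V) (y : V) :
    ∀ (m : ℕ) (c : ℝ), |c| ≤ 1 → Set.InjOn p (Set.Iic m) → (∀ i ≤ m, p i ≠ y) →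
    lmarginal (fun _ => coin) ((Finset.Icc 1 m).image p)
      (fun ω => (∏ i ∈ Finset.range m, flip (b i) (ω (p i)) (ω (p (i + 1))))
        * flip c (ω (p m)) (ω y))
      = fun ω => flip ((∏ i ∈ Finset.range m, b i) * c) (ω (p 0)) (ω y) := by
  intro m
  induction m with
  | zero => intro c _ _ _; simp
  | succ m ih =>
    intro c hc hp hy
    have hne : ∀ i ≤ m, p i ≠ p (m + 1) := fun i hi h => by
      have := hp (show i ≤ m + 1 by omega) (show m + 1 ≤ m + 1 by omega) h
      omega
    have hmem : p (m + 1) ∉ (Finset.Icc 1 m).image p := by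
      simp only [Finset.mem_image, Finset.mem_Icc, not_exists, not_and]
      exact fun i hi => hne i hi.2
    rw [← Finset.insert_Icc_right_eq_Icc_add_one (by omega : 1 ≤ m + 1), Finset.image_insert,
      lmarginal_insert' _ .of_discrete hmem]
    have hbc : |b m * c| ≤ 1 := by
      rw [abs_mul]
      exact mul_le_one₀ (hb m) (abs_nonneg c) hc
    have := ih (b m * c) hbc (hp.mono fun i (hi : i ≤ m) => Nat.le_succ_of_le hi)
      fun i hi => hy i (by omega)
    rw [Finset.prod_range_succ, mul_assoc, ← this]
    congr 1
    funext ω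
    have hprod : ∀ t, ∏ i ∈ Finset.range m, flip (b i) (Function.update ω (p (m + 1)) t (p i))
        (Function.update ω (p (m + 1)) t (p (i + 1)))
        = ∏ i ∈ Finset.range m, flip (b i) (ω (p i)) (ω (p (i + 1))) := fun t =>
      Finset.prod_congr rfl fun i hi => by
        rw [Finset.mem_range] at hi
        rw [Function.update_of_ne (hne i (by omega)),
          Function.update_of_ne (hne (i + 1) (by omega))]
    simp only [Finset.prod_range_succ, hprod, Function.update_self,
      Function.update_of_ne (hne m le_rfl), Function.update_of_ne (hy (m + 1) le_rfl).symm,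
      mul_assoc]
    rw [lintegral_const_mul _ .of_discrete, lintegral_flip_mul_flip (hb m) hc]

/-- Integrating out all nodes but the end nodes of a path from a product of pairwise densities
along the path multiplies the correlations. -/
theorem lmarginal_path (b : ℕ → ℝ) (hb : ∀ i, |b i| ≤ 1) (p : ℕ → V) (k : ℕ) (hk : k ≠ 0)
    (hp : Set.InjOn p (Set.Iic k)) :
    lmarginal (fun _ => coin) {p 0, p k}ᶜ
      (fun ω => ∏ i ∈ Finset.range k, flip (b i) (ω (p i)) (ω (p (i + 1))))
      = fun ω => flip (∏ i ∈ Finset.range k, b i) (ω (p 0)) (ω (p k)) := by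
  obtain ⟨m, rfl⟩ := Nat.exists_eq_succ_of_ne_zero hk
  have hinj : ∀ i ≤ m + 1, ∀ j ≤ m + 1, p i = p j → i = j := fun i hi j hj h => hp hi hj h
  have hsub : (Finset.Icc 1 m).image p ⊆ ({p 0, p (m + 1)}ᶜ : Finset V) := by
    intro v hv
    simp only [Finset.mem_image, Finset.mem_Icc] at hv
    obtain ⟨i, hi, rfl⟩ := hv
    simp only [Finset.mem_compl, Finset.mem_insert, Finset.mem_singleton, not_or]
    constructor
    · intro h; have := hinj i (by omega) 0 (by omega) h; omega
    · intro h; have := hinj i (by omega) (m + 1) (by omega) h; omega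
  -- Nodes off the path do not occur in the integrand, so integrating them out against a probability
  -- measure changes nothing.
  rw [Nat.succ_eq_add_one, ← Finset.union_sdiff_of_subset hsub,
    lmarginal_union _ _ .of_discrete Finset.disjoint_sdiff,
    lmarginal_eq_self_of_forall _ ({p 0, p (m + 1)}ᶜ \ (Finset.Icc 1 m).image p)]
  · simp only [Finset.prod_range_succ]
    refine lmarginal_chain b hb p _ m _ (hb m)
      (hp.mono fun i (hi : i ≤ m) => Nat.le_succ_of_le hi) fun i hi h => ?_
    have := hinj i (by omega) (m + 1) le_rfl h
    omega
  · intro ω ω' h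
    have hmem : ∀ i ≤ m + 1, ω (p i) = ω' (p i) := by
      intro i hi
      apply h
      simp only [Finset.mem_sdiff, Finset.mem_compl, Finset.mem_insert, Finset.mem_singleton,
        Finset.mem_image, Finset.mem_Icc]
      rintro ⟨h1, h2⟩
      refine h2 ⟨i, ⟨?_, ?_⟩, rfl⟩
      · by_contra h0
        exact h1 (.inl (by rw [show i = 0 by omega]))
      · by_contra h0
        exact h1 (.inr (by rw [show i = m + 1 by omega]))
    refine Finset.prod_congr rfl fun i hi => ?_
    rw [Finset.mem_range] at hi
    rw [hmem i (by omega), hmem (i + 1) (by omega)]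

end Chain

/-! ### The coin model on a collider-free path -/

section PathModel

variable {V : Type*}

open Classical in
/-- The end node of the `i`-th edge of the path `p` to which this edge points. -/
noncomputable def pathHead (D : CausalDAG V) (p : ℕ → V) (i : ℕ) : V :=
  if D.edge (p i) (p (i + 1)) then p (i + 1) else p i

theorem pathHead_of_edge {D : CausalDAG V} {p : ℕ → V} {i : ℕ} (h : D.edge (p i) (p (i + 1))) :
    D.pathHead p i = p (i + 1) := if_pos h

theorem pathHead_of_not_edge {D : CausalDAG V} {p : ℕ → V} {i : ℕ}
    (h : ¬ D.edge (p i) (p (i + 1))) : D.pathHead p i = p i := if_neg h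

/-- `p 0, …, p k` are the nodes of a path of `D` without colliders. -/
structure IsTrek (D : CausalDAG V) (k : ℕ) (p : ℕ → V) : Prop where
  injOn : Set.InjOn p (Set.Iic k)
  edge : ∀ i < k, D.edge (p i) (p (i + 1)) ∨ D.edge (p (i + 1)) (p i)
  not_collider : ∀ i, i + 2 ≤ k →
    ¬ (D.edge (p i) (p (i + 1)) ∧ D.edge (p (i + 2)) (p (i + 1)))

variable {D : CausalDAG V} {k : ℕ} {p : ℕ → V}

/-- Two edges with a common head would form a collider. Hence each conditional density of
`pathModel` has at most one nontrivial factor, and so is normalized. -/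
theorem IsTrek.pathHead_injOn (h : D.IsTrek k p) : Set.InjOn (D.pathHead p) (Set.Iio k) := by
  have key : ∀ i j, i < j → j < k → D.pathHead p i ≠ D.pathHead p j := by
    intro i j hij hj heq
    have hinj : ∀ a ≤ k, ∀ b ≤ k, p a = p b → a = b := fun a ha b hb hab => h.injOn ha hb hab
    by_cases hi' : D.edge (p i) (p (i + 1)) <;> by_cases hj' : D.edge (p j) (p (j + 1))
    · rw [pathHead_of_edge hi', pathHead_of_edge hj'] at heq
      have := hinj _ (by omega) _ (by omega) heq
      omega
    · rw [pathHead_of_edge hi', pathHead_of_not_edge hj'] at heq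
      obtain rfl := hinj _ (by omega) _ (by omega) heq
      exact h.not_collider i (by omega) ⟨hi', (h.edge (i + 1) hj).resolve_left hj'⟩
    · rw [pathHead_of_not_edge hi', pathHead_of_edge hj'] at heq
      have := hinj _ (by omega) _ (by omega) heq
      omega
    · rw [pathHead_of_not_edge hi', pathHead_of_not_edge hj'] at heq
      have := hinj _ (by omega) _ (by omega) heq
      omega
  intro i hi j hj heq
  by_contra hne
  rcases lt_or_gt_of_ne hne with hlt | hlt
  · exact key i j hlt hj heq
  · exact key j i hlt hi heq.symm

variable [Fintype V] [DecidableEq V]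

/-- Fair coins at all nodes, where neighbours along the path have correlation `1 / 2`. -/
noncomputable def pathModel (h : D.IsTrek k p) :
    D.Model (fun _ => Bool) (fun _ => coin) where
  cond v ω := ∏ i ∈ Finset.range k,
    if D.pathHead p i = v then flip (1 / 2) (ω (p i)) (ω (p (i + 1))) else 1
  measurable_cond v := .of_discrete
  cond_pos v ω := by
    refine CanonicallyOrderedAdd.prod_pos.2 fun i _ => ?_
    split_ifs
    · exact flip_pos (by norm_num [abs_lt]) _ _
    · exact one_pos
  cond_ne_top v ω := by
    refine ENNReal.prod_ne_top fun i _ => ?_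
    split_ifs
    · exact ENNReal.ofReal_ne_top
    · exact ENNReal.one_ne_top
  cond_local v ω ω' hv hpa := by
    refine Finset.prod_congr rfl fun i hi => ?_
    rw [Finset.mem_range] at hi
    split_ifs with hhead
    · by_cases he : D.edge (p i) (p (i + 1))
      · rw [pathHead_of_edge he] at hhead
        subst hhead
        rw [hv, hpa _ he]
      · have he' := (h.edge i hi).resolve_left he
        rw [pathHead_of_not_edge he] at hhead
        subst hhead
        rw [hv, hpa _ he']
    · rfl
  cond_normalized v ω := by
    by_cases hex : ∃ i < k, D.pathHead p i = v
    · obtain ⟨i, hi, hiv⟩ := hex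
      have hprod : ∀ ω : V → Bool, (∏ j ∈ Finset.range k,
          if D.pathHead p j = v then flip (1 / 2) (ω (p j)) (ω (p (j + 1))) else 1)
          = flip (1 / 2) (ω (p i)) (ω (p (i + 1))) := by
        intro ω
        rw [Finset.prod_eq_single i, if_pos hiv]
        · intro j hj hji
          refine if_neg fun hjv => hji (h.pathHead_injOn (Finset.mem_range.1 hj) hi ?_)
          rw [hjv, hiv]
        · exact fun hn => absurd (Finset.mem_range.2 hi) hn
      simp only [hprod]
      have hne : p i ≠ p (i + 1) := fun he => by
        have := h.injOn (show i ≤ k by omega) (show i + 1 ≤ k by omega) he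
        omega
      by_cases he : D.edge (p i) (p (i + 1))
      · rw [pathHead_of_edge he] at hiv
        subst hiv
        simp only [Function.update_self, Function.update_of_ne hne]
        simp only [flip_comm _ (ω (p i))]
        exact lintegral_flip (by norm_num [abs_le]) _
      · rw [pathHead_of_not_edge he] at hiv
        subst hiv
        simp only [Function.update_self, Function.update_of_ne hne.symm]
        exact lintegral_flip (by norm_num [abs_le]) _
    · push Not at hex
      have hprod : ∀ ω : V → Bool, (∏ j ∈ Finset.range k,
          if D.pathHead p j = v then flip (1 / 2) (ω (p j)) (ω (p (j + 1))) else 1) = 1 :=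
        fun ω => Finset.prod_eq_one fun j hj => if_neg (hex j (Finset.mem_range.1 hj))
      rw [lintegral_congr fun t => hprod _, lintegral_one, measure_univ]

/-- Since `flip 0` is 1, a deleted factor counts as correlation 0, so truncated products are still
chains. -/
theorem prod_pathModel_cond (h : D.IsTrek k p) (s : Finset V) (ω : V → Bool) :
    ∏ v ∈ s, (pathModel h).cond v ω = ∏ i ∈ Finset.range k,
      flip (if D.pathHead p i ∈ s then 1 / 2 else 0) (ω (p i)) (ω (p (i + 1))) := by
  change ∏ v ∈ s, ∏ i ∈ Finset.range k,
    (if D.pathHead p i = v then flip (1 / 2) (ω (p i)) (ω (p (i + 1))) else 1) = _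
  rw [Finset.prod_comm]
  refine Finset.prod_congr rfl fun i _ => ?_
  rw [Finset.prod_ite_eq]
  split_ifs <;> simp

theorem pathModel_density (h : D.IsTrek k p) :
    (pathModel h).density = fun ω => ∏ i ∈ Finset.range k,
      flip (1 / 2) (ω (p i)) (ω (p (i + 1))) := by
  funext ω
  simp [Model.density, prod_pathModel_cond]

theorem pathModel_doDensity (h : D.IsTrek k p) (hk : k ≠ 0) :
    (pathModel h).doDensity (p 0) (p k) = fun ω =>
      flip (∏ i ∈ Finset.range k, if D.pathHead p i = p 0 then 0 else 1 / 2)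
        (ω (p 0)) (ω (p k)) := by
  funext ω
  simp only [Model.doDensity, prod_pathModel_cond]
  refine Eq.trans ?_ (congrFun (lmarginal_path
    (fun i => if D.pathHead p i = p 0 then 0 else 1 / 2) ?_ p k hk h.injOn) ω)
  · simp only [Finset.mem_erase, Finset.mem_univ, and_true, ne_eq, ite_not]
  · intro i
    split_ifs <;> norm_num [abs_le]

/-- The joint density does not depend on the orientation of the path edges, and the formula sees
only that density. -/
theorem pathModel_adjusted_eq {D' : CausalDAG V} (h : D.IsTrek k p) (h' : D'.IsTrek k p)
    (X Y : V) (Z : Finset V) : (pathModel h).adjusted X Y Z = (pathModel h').adjusted X Y Z := by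
  have hm : (pathModel h).marginal = (pathModel h').marginal := by
    funext S ω
    simp only [Model.marginal, pathModel_density]
  unfold Model.adjusted
  rw [hm]

/-- If a path without colliders starts with an edge into its first node in one DAG and is directed
from its first to its last node in another one, then these DAGs share no valid adjustment set. -/
theorem not_common_adjustmentSet {D' : CausalDAG V} (hk : k ≠ 0)
    (hp : D.IsDirectedPath (p 0) (p k) k p) (h' : D'.IsTrek k p)
    (h0 : ¬ D'.edge (p 0) (p 1)) {Z : Finset V}
    (hZ : D.IsValidAdjustmentSet (p 0) (p k) Z) (hZ' : D'.IsValidAdjustmentSet (p 0) (p k) Z) :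
    False := by
  have h : D.IsTrek k p := ⟨hp.injOn, fun i hi => .inl (hp.2.2 i hi),
    fun i hi hc => not_edge_of_edge (hp.2.2 (i + 1) (by omega)) hc.2⟩
  have e := eq_of_ae_eq_pi_coin (hZ.2.2 _ _ (pathModel h))
  have e' := eq_of_ae_eq_pi_coin (hZ'.2.2 _ _ (pathModel h'))
  rw [pathModel_adjusted_eq h h', ← e', pathModel_doDensity h hk, pathModel_doDensity h' hk] at e
  -- At this point the equality reads 1 + (1/2)^k = 1 + 0.
  have e1 := congrFun e fun _ => true
  have hprod : (∏ i ∈ Finset.range k, if D.pathHead p i = p 0 then (0 : ℝ) else 1 / 2)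
      = (1 / 2) ^ k := by
    rw [Finset.prod_congr rfl (g := fun _ => (1 / 2 : ℝ)), Finset.prod_const, Finset.card_range]
    intro i hi
    rw [Finset.mem_range] at hi
    refine if_neg fun hc => ?_
    rw [pathHead_of_edge (hp.2.2 i hi)] at hc
    have := h.injOn (show i + 1 ≤ k by omega) (show 0 ≤ k by omega) hc
    omega
  have hprod' : (∏ i ∈ Finset.range k, if D'.pathHead p i = p 0 then (0 : ℝ) else 1 / 2) = 0 :=
    Finset.prod_eq_zero (Finset.mem_range.2 (Nat.pos_of_ne_zero hk))
      (if_pos (pathHead_of_not_edge h0))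
  simp only [hprod, hprod', flip, if_true] at e1
  have hpos : (0 : ℝ) < (1 / 2) ^ k := by positivity
  rw [ENNReal.ofReal_eq_ofReal_iff (by linarith) (by norm_num)] at e1
  linarith

end PathModel

end CausalDAG

/-! ### The main theorem -/

open CausalDAG in
theorem mainTheorem4 {V : Type*} [Fintype V] [DecidableEq V] (G : MixedGraph V)
    (hG : G.IsCPDAG) (X Y : V) (hXY : X ≠ Y) (hposs : X ∈ G.possAn Y)
    (hid : G.Identifiable X Y) : X ∈ G.explAn Y := by
  obtain ⟨D, hD, hanc⟩ := hposs
  obtain ⟨Z, hZ⟩ := hid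
  obtain ⟨k, p, hp, hunsh⟩ := hanc.exists_unshielded
  obtain ⟨rfl, rfl, hedge⟩ := id hp
  have hk : k ≠ 0 := by
    rintro rfl
    exact hXY rfl
  have hadj : ∀ i < k, D.skeleton.Adj (p i) (p (i + 1)) :=
    fun i hi => skeleton_adj.2 (.inl (hedge i hi))
  have hcol : ∀ D', D.MarkovEquiv D' → ∀ i, i + 2 ≤ k →
      ¬ (D'.edge (p i) (p (i + 1)) ∧ D'.edge (p (i + 2)) (p (i + 1))) := by
    intro D' hE i hi
    refine hE.not_collider (hadj i (by omega)) (hadj (i + 1) (by omega)) (fun he => ?_)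
      (hunsh i hi) fun hc => not_edge_of_edge (hedge (i + 1) (by omega)) hc.2
    have := hp.injOn (show i ≤ k by omega) (show i + 2 ≤ k by omega) he
    omega
  have hadj' : ∀ D', D.MarkovEquiv D' → ∀ i < k,
      D'.edge (p i) (p (i + 1)) ∨ D'.edge (p (i + 1)) (p i) :=
    fun D' hE i hi => skeleton_adj.1 (hE.adj_of_adj (hadj i hi))
  by_cases hfirst : ∀ D', D.MarkovEquiv D' → D'.edge (p 0) (p 1)
  · have hall : ∀ D', D.MarkovEquiv D' → ∀ i < k, D'.edge (p i) (p (i + 1)) := by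
      intro D' hE i
      induction i with
      | zero => exact fun _ => hfirst D' hE
      | succ i ih =>
        exact fun hi => (hadj' D' hE (i + 1) hi).resolve_right
          fun hc => hcol D' hE i (by omega) ⟨ih (by omega), hc⟩
    have hreach : ∀ i ≤ k, Relation.ReflTransGen G.dir (p 0) (p i) := by
      intro i
      induction i with
      | zero => exact fun _ => .refl
      | succ i ih =>
        refine fun hi => (ih (by omega)).tail ?_
        have hD' : D.cpdag = G := hD
        rw [← hD']
        exact fun D' hE => hall D' hE i (by omega)
    exact hreach k le_rfl
  · push Not at hfirst
    obtain ⟨D', hE, h0⟩ := hfirst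
    have hD' : D' ∈ G.mec := hE.cpdag_eq.symm.trans hD
    exact (not_common_adjustmentSet hk hp ⟨hp.injOn, hadj' D' hE, hcol D' hE⟩ h0
      (hZ D hD) (hZ D' hD')).elim
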